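/- Let $\mathbb T=(\mathbb R\cup\{-\infty\};\oplus,\odot)$ be the tropical semiring with $a\oplus b=\max\{a,b\}$ and $a\odot b=a+b$, let $\overline{\mathbb Z}=\mathbb Z\cup\{-\infty\}$ with the same operations, and for $S\in\{\mathbb T,\overline{\mathbb Z}\}$ let $U_2(S)$ be the monoid of $2\times 2$ upper triangular matrices over $S$ under matrix multiplication. A semigroup identity is a pair $\mathbf u\approx\mathbf v$ of nonempty words over a countably infinite alphabet. A semigroup is finitely based if all the identities that it satisfies can be derived from finitely many of them, and nonfinitely based otherwise. Then the following hold. (1) The monoid $U_2(\overline{\mathbb Z})$ is nonfinitely based (as a semigroup). (2) $U_2(\overline{\mathbb Z})$ is a submonoid of $U_2(\mathbb T)$: the entrywise inclusion is an injective monoid homomorphism. (3) For every $n\ge 1$, $U_2(\overline{\mathbb Z})$ satisfies the identity $\mathbf p\mathbf q\mathbf p\mathbf p\mathbf q\approx \mathbf p\mathbf q\mathbf q\mathbf p\mathbf q$, where $\mathbf p=x_1x_2\cdots x_n$ and $\mathbf q=x_n\cdots x_2x_1$. (4) $U_2(\overline{\mathbb Z})$ contains, as a subsemigroup, a copy of the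 bicyclic monoid $\langle A,B\mid AB=1\rangle$: there is an injective semigroup homomorphism from the bicyclic monoid to $U_2(\overline{\mathbb Z})$ that sends $$A\mapsto\begin{pmatrix}-1&1\\-\infty&1\end{pmatrix},\qquad B\mapsto\begin{pmatrix}1&1\\-\infty&-1\end{pmatrix}.$$ -/

import Mathlib

/-! ### Tropical matrices -/

/-- The max-plus tropical semiring `R ∪ {-∞}`, for a linearly ordered additive monoid `R`.
Mathlib's `Tropical` is the min-plus construction, so it is applied to `R` with the reversed order
and a new top element, which plays the role of `-∞`. The lemmas below record that in terms of
`WithBot R = R ∪ {-∞}` addition is the maximum and multiplication is the usual addition. -/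
abbrev MaxPlus (R : Type*) : Type _ := Tropical (WithTop Rᵒᵈ)

namespace MaxPlus

/-- The elements of the max-plus semiring are exactly the elements of `R ∪ {-∞}`. -/
def ofBot {R : Type*} : WithBot R ≃ MaxPlus R :=
  WithBot.toDual.trans Tropical.tropEquiv

theorem ofBot_bot {R : Type*} [AddCommMonoid R] [LinearOrder R] [IsOrderedAddMonoid R] :
    ofBot (⊥ : WithBot R) = 0 := rfl

theorem ofBot_zero {R : Type*} [AddCommMonoid R] [LinearOrder R] [IsOrderedAddMonoid R] :
    ofBot (0 : WithBot R) = 1 := rfl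

theorem ofBot_max {R : Type*} [AddCommMonoid R] [LinearOrder R] [IsOrderedAddMonoid R]
    (a b : WithBot R) : ofBot (max a b) = ofBot a + ofBot b := by
  apply Tropical.untrop_injective
  rw [Tropical.untrop_add]
  change WithBot.toDual (max a b) = min (WithBot.toDual a) (WithBot.toDual b)
  rcases le_total a b with h | h
  · rw [max_eq_right h, min_eq_right (WithBot.toDual_le_toDual_iff.2 h)]
  · rw [max_eq_left h, min_eq_left (WithBot.toDual_le_toDual_iff.2 h)]

theorem ofBot_add {R : Type*} [AddCommMonoid R] [LinearOrder R] [IsOrderedAddMonoid R]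
    (a b : WithBot R) : ofBot (a + b) = ofBot a * ofBot b := by
  cases a <;> cases b <;> rfl

/-- The inclusion of `ℤ ∪ {-∞}` in `ℝ ∪ {-∞}`. -/
def intToReal (a : MaxPlus ℤ) : MaxPlus ℝ :=
  ofBot ((ofBot.symm a).map (fun k : ℤ => (k : ℝ)))

end MaxPlus

/-- The multiplicative monoid of `2 × 2` upper triangular matrices over a semiring. -/
def upperTriangular₂ (S : Type*) [Semiring S] : Submonoid (Matrix (Fin 2) (Fin 2) S) where
  carrier := {M | M.IsUpperTriangular}
  mul_mem' hM hN := Matrix.BlockTriangular.mul hM hN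
  one_mem' := Matrix.blockTriangular_one

/-! ### Semigroup identities and the finite basis property -/

/-- Nonempty words over the countably infinite alphabet `ℕ`: the free semigroup. -/
abbrev Word : Type := FreeSemigroup ℕ

/-- A semigroup identity `u ≈ v` is a pair of nonempty words. -/
abbrev SemigroupIdentity : Type := Word × Word

/-- `S` satisfies the identity `u ≈ v`: every assignment gives `u` and `v` the same value. -/
def SatisfiesIdentity (S : Type*) [Semigroup S] (e : SemigroupIdentity) : Prop :=
  ∀ φ : Word →ₙ* S, φ e.1 = φ e.2

/-- The set of all identities satisfied by `S`. -/
def identitiesOf (S : Type*) [Semigroup S] : Set SemigroupIdentity :=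
  {e | SatisfiesIdentity S e}

/-- The set of all identities that can be derived from `E`: the congruence on the free semigroup
generated by all substitution instances of the identities in `E`. -/
def consequences (E : Set SemigroupIdentity) : Set SemigroupIdentity :=
  {e | conGen (fun p q : Word => ∃ d ∈ E, ∃ θ : Word →ₙ* Word, p = θ d.1 ∧ q = θ d.2) e.1 e.2}

/-- `E` is an identity basis for `S`. -/
def IsIdentityBasis (S : Type*) [Semigroup S] (E : Set SemigroupIdentity) : Prop :=
  E ⊆ identitiesOf S ∧ consequences E = identitiesOf S

/-- `S` is finitely based: it possesses a finite identity basis. -/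
def FinitelyBased (S : Type*) [Semigroup S] : Prop :=
  ∃ E : Set SemigroupIdentity, E.Finite ∧ IsIdentityBasis S E

/-! ### The identities `u_n ≈ v_n` -/

/-- `ascWord k` is the word `x_1 x_2 ⋯ x_{k+1}`, where `x_i` is the letter `i`. -/
def ascWord : ℕ → Word
  | 0 => FreeSemigroup.of 1
  | k + 1 => ascWord k * FreeSemigroup.of (k + 2)

/-- `descWord k` is the word `x_{k+1} ⋯ x_2 x_1`, where `x_i` is the letter `i`. -/
def descWord : ℕ → Word
  | 0 => FreeSemigroup.of 1
  | k + 1 => FreeSemigroup.of (k + 2) * descWord k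

/-- For `n = k + 1`, `p = x_1 ⋯ x_n` and `q = x_n ⋯ x_1`, the identity `p q p p q ≈ p q q p q`. -/
def adjanIdentity (k : ℕ) : SemigroupIdentity :=
  (ascWord k * descWord k * ascWord k * ascWord k * descWord k,
    ascWord k * descWord k * descWord k * ascWord k * descWord k)

/-! ### The bicyclic monoid -/

/-- The defining relation `A B = 1`, where `A` is the generator `0` and `B` the generator `1`. -/
def bicyclicRel (u v : FreeMonoid (Fin 2)) : Prop :=
  u = FreeMonoid.of 0 * FreeMonoid.of 1 ∧ v = 1

/-- The bicyclic monoid `⟨A, B | A B = 1⟩`. -/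
abbrev BicyclicMonoid : Type := PresentedMonoid bicyclicRel

/-! ### Upper triangular matrices -/

namespace upperTriangular₂

variable {S : Type*} [Semiring S]

/-! The corner entry of a product of upper triangular matrices is a tropical sum over the factor at
which one passes from row 0 to row 1. So an identity constrains, for each letter, the weights of the
prefixes preceding its occurrences, and only their maxima under each linear weight matter
(`tropicallyEquiv_of_satisfiesIdentity`).

For `p q p p q`, the third prefix preceding a letter gives a non-extremal point while the other four
are exposed. The outer blocks of an equivalent word are therefore forced, and two-sided bounds force
the middle block to be `p` or `q` (`TropicallyEquiv.eq_or_eq`). Both words do occur, since the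
differing corner term `a² d²` is absorbed by others (`MaxPlus.mk_mul_mk_identity`).

An identity shorter than `n` cannot lead from one word to the other. Some letter's image would cover
a factor `xⱼ₊₁ xⱼ₊₂` of the middle `p`; that letter would have to occur at least three times, yet `p
q q p q` contains the factor only twice (`TropicallyEquiv.not_substitution`). A finite basis has
bounded lengths, so for large `n` it leaves `p q p p q` alone in its class, although the identity
with `p q q p q` holds.

The bicyclic monoid embeds through its normal forms `B ^ m * A ^ k`, whose matrices recover `m` and
`k`. -/

theorem entry_one_zero (M : upperTriangular₂ S) : (M : Matrix (Fin 2) (Fin 2) S) 1 0 = 0 :=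
  M.2 (by decide : (0 : Fin 2) < 1)

/-- The upper triangular matrix with diagonal entries `a`, `d` and corner entry `b`. -/
def mk (a b d : S) : upperTriangular₂ S :=
  ⟨!![a, b; 0, d], by
    intro i j hij
    fin_cases i <;> fin_cases j <;> simp_all⟩

theorem coe_mk (a b d : S) : (mk a b d : Matrix (Fin 2) (Fin 2) S) = !![a, b; 0, d] := rfl

theorem mk_mul_mk (a b d a' b' d' : S) :
    mk a b d * mk a' b' d' = mk (a * a') (a * b' + b * d') (d * d') := by
  apply Subtype.ext
  rw [Submonoid.coe_mul, coe_mk, coe_mk, coe_mk, Matrix.mul_fin_two]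
  simp

theorem eq_mk (M : upperTriangular₂ S) :
    M = mk ((M : Matrix (Fin 2) (Fin 2) S) 0 0) ((M : Matrix (Fin 2) (Fin 2) S) 0 1)
      ((M : Matrix (Fin 2) (Fin 2) S) 1 1) := by
  apply Subtype.ext
  ext i j
  fin_cases i <;> fin_cases j <;> simp [coe_mk, entry_one_zero]

theorem mk_injective {a b d a' b' d' : S} (h : mk a b d = mk a' b' d') :
    a = a' ∧ b = b' ∧ d = d' := by
  have h' : (mk a b d : Matrix (Fin 2) (Fin 2) S) = mk a' b' d' := congrArg _ h
  exact ⟨congrFun (congrFun h' 0) 0, congrFun (congrFun h' 0) 1, congrFun (congrFun h' 1) 1⟩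

theorem mul_entry_zero_zero (M N : upperTriangular₂ S) :
    (M * N : Matrix (Fin 2) (Fin 2) S) 0 0 =
      (M : Matrix (Fin 2) (Fin 2) S) 0 0 * (N : Matrix (Fin 2) (Fin 2) S) 0 0 := by
  simp [Matrix.mul_apply, Fin.sum_univ_two, entry_one_zero]

theorem mul_entry_one_one (M N : upperTriangular₂ S) :
    (M * N : Matrix (Fin 2) (Fin 2) S) 1 1 =
      (M : Matrix (Fin 2) (Fin 2) S) 1 1 * (N : Matrix (Fin 2) (Fin 2) S) 1 1 := by
  simp [Matrix.mul_apply, Fin.sum_univ_two, entry_one_zero]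

end upperTriangular₂

/-! ### The Adjan identities -/

namespace MaxPlus

/-- In max-plus terms `2a + d` lies between `3a` and `3d`, so it never exceeds both. The order on
`MaxPlus` is reversed: a sum equals its smaller term. -/
theorem cube_add_cube (a d : MaxPlus ℤ) : a ^ 3 + d ^ 3 + a ^ 2 * d = a ^ 3 + d ^ 3 := by
  rcases le_total a d with h | h
  · have h1 : a ^ 3 ≤ a ^ 2 * d := by
      rw [pow_succ]
      exact mul_le_mul_right h _
    rw [add_right_comm, Tropical.add_eq_left h1]
  · have h1 : d ^ 3 ≤ a ^ 2 * d := by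
      rw [pow_succ]
      exact mul_le_mul_left (pow_le_pow_left' h 2) _
    rw [add_assoc, Tropical.add_eq_left h1]

theorem mk_mul_mk_identity (a b c d : MaxPlus ℤ) :
    upperTriangular₂.mk a b d * upperTriangular₂.mk a c d * upperTriangular₂.mk a b d * upperTriangular₂.mk a b d * upperTriangular₂.mk a c d =
      upperTriangular₂.mk a b d * upperTriangular₂.mk a c d * upperTriangular₂.mk a c d * upperTriangular₂.mk a b d * upperTriangular₂.mk a c d := by
  simp only [upperTriangular₂.mk_mul_mk]
  congr 1
  -- The two corner entries differ only in the term `a² d²`, with coefficient `b` on one side and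
  -- `c` on the other; each copy is absorbed by the cubes.
  have h1 := congrArg (fun x => b * d * x) (cube_add_cube a d)
  have h2 := congrArg (fun x => c * a * x) (cube_add_cube d a)
  calc _ = b * d * (a ^ 3 + d ^ 3 + a ^ 2 * d) + c * a * (d ^ 3 + a ^ 3) := by ring
    _ = b * d * (a ^ 3 + d ^ 3) + c * a * (d ^ 3 + a ^ 3 + d ^ 2 * a) := by rw [h1, h2]
    _ = _ := by ring

end MaxPlus

theorem diagonal_ascWord_eq (φ : Word →ₙ* upperTriangular₂ (MaxPlus ℤ)) (k : ℕ) :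
    (φ (ascWord k) : Matrix (Fin 2) (Fin 2) (MaxPlus ℤ)) 0 0 =
      (φ (descWord k) : Matrix (Fin 2) (Fin 2) (MaxPlus ℤ)) 0 0 ∧
    (φ (ascWord k) : Matrix (Fin 2) (Fin 2) (MaxPlus ℤ)) 1 1 =
      (φ (descWord k) : Matrix (Fin 2) (Fin 2) (MaxPlus ℤ)) 1 1 := by
  induction k with
  | zero => exact ⟨rfl, rfl⟩
  | succ k ih =>
    simp only [ascWord, descWord, map_mul, Submonoid.coe_mul,
      upperTriangular₂.mul_entry_zero_zero, upperTriangular₂.mul_entry_one_one, ih.1, ih.2]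
    exact ⟨mul_comm _ _, mul_comm _ _⟩

theorem satisfiesIdentity_adjanIdentity (k : ℕ) :
    SatisfiesIdentity (upperTriangular₂ (MaxPlus ℤ)) (adjanIdentity k) := by
  intro φ
  obtain ⟨h0, h1⟩ := diagonal_ascWord_eq φ k
  simp only [adjanIdentity, map_mul]
  rw [upperTriangular₂.eq_mk (φ (ascWord k)), upperTriangular₂.eq_mk (φ (descWord k)), h0, h1]
  exact MaxPlus.mk_mul_mk_identity _ _ _ _

/-! ### The inclusion of integer in real matrices -/

namespace MaxPlus

/-- The inclusion of `ℤ ∪ {-∞}` in `ℝ ∪ {-∞}` as a homomorphism of semirings. -/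
def intToRealHom : MaxPlus ℤ →+* MaxPlus ℝ where
  toFun := intToReal
  map_zero' := rfl
  map_one' := by
    change ofBot (((0 : ℤ) : ℝ) : WithBot ℝ) = ofBot ((0 : ℝ) : WithBot ℝ)
    rw [Int.cast_zero]
  map_add' x y := by
    obtain ⟨a, rfl⟩ := ofBot.surjective x
    obtain ⟨b, rfl⟩ := ofBot.surjective y
    rw [← ofBot_max]
    simp only [intToReal, Equiv.symm_apply_apply]
    rw [← ofBot_max]
    congr 1
    exact (WithBot.monotone_map_iff.2 Int.cast_mono).map_max
  map_mul' x y := by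
    obtain ⟨a, rfl⟩ := ofBot.surjective x
    obtain ⟨b, rfl⟩ := ofBot.surjective y
    rw [← ofBot_add]
    simp only [intToReal, Equiv.symm_apply_apply]
    rw [← ofBot_add]
    congr 1
    cases a <;> cases b <;> try rfl
    simp only [← WithBot.coe_add, WithBot.map_coe, Int.cast_add]

theorem intToReal_injective : Function.Injective intToReal :=
  ofBot.injective.comp ((Option.map_injective Int.cast_injective).comp ofBot.symm.injective)

end MaxPlus

/-- The monoid homomorphism of upper triangular matrices induced by a homomorphism of semirings. -/
def upperTriangular₂.map {S T : Type*} [Semiring S] [Semiring T] (g : S →+* T) :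
    upperTriangular₂ S →* upperTriangular₂ T where
  toFun M := ⟨(M : Matrix (Fin 2) (Fin 2) S).map g, fun i j hij => by
    rw [Matrix.map_apply, M.2 hij, map_zero]⟩
  map_one' := Subtype.ext (Matrix.map_one g (map_zero g) (map_one g))
  map_mul' M N := Subtype.ext (Matrix.map_mul (L := M.1) (M := N.1) (f := g))

theorem upperTriangular₂.map_injective {S T : Type*} [Semiring S] [Semiring T] (g : S →+* T)
    (hg : Function.Injective g) : Function.Injective (upperTriangular₂.map g) := by
  intro M N h
  apply Subtype.ext
  ext i j
  exact hg (congrFun (congrFun (congrArg Subtype.val h) i) j)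

/-! ### The copy of the bicyclic monoid -/

namespace Bicyclic

/-- The matrix of `B ^ m * A ^ k`. -/
def matrix (m k : ℕ) : upperTriangular₂ (MaxPlus ℤ) :=
  upperTriangular₂.mk (MaxPlus.ofBot ((m - k : ℤ) : WithBot ℤ)) (MaxPlus.ofBot ((m + k : ℤ) : WithBot ℤ))
    (MaxPlus.ofBot ((k - m : ℤ) : WithBot ℤ))

theorem matrix_injective {m k m' k' : ℕ} (h : matrix m k = matrix m' k') : m = m' ∧ k = k' := by
  obtain ⟨h1, h2, -⟩ := upperTriangular₂.mk_injective h
  have h1 := WithBot.coe_injective (MaxPlus.ofBot.injective h1)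
  have h2 := WithBot.coe_injective (MaxPlus.ofBot.injective h2)
  omega

/-- The two truncated differences add up to `|m' - k|`, which is also the maximum of `m' - k` and `k
- m'` appearing in the corner. -/
theorem matrix_mul (m k m' k' : ℕ) :
    matrix m k * matrix m' k' = matrix (m + (m' - k)) (k' + (k - m')) := by
  simp only [matrix, upperTriangular₂.mk_mul_mk, ← MaxPlus.ofBot_add, ← MaxPlus.ofBot_max,
    ← WithBot.coe_add, ← WithBot.coe_max]
  congr 3
  · push_cast; omega
  · push_cast; omega
  · push_cast; omega

/-- The images of the words in the generators `A` (the letter `0`) and `B` (the letter `1`). -/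
def eval : FreeMonoid (Fin 2) →* upperTriangular₂ (MaxPlus ℤ) :=
  FreeMonoid.lift ![matrix 0 1, matrix 1 0]

/-- The idempotent `matrix 0 0` has corner `0`, not `-∞`, so it is not the identity matrix.
Multiplying by it makes `A B` and the empty word agree, which is why the embedding preserves
products but not the unit. The same `m` and `k` serve in the monoid and in the matrices; this gives
injectivity. -/
theorem matrix_zero_mul_eval (w : FreeMonoid (Fin 2)) :
    ∃ m k, matrix 0 0 * eval w = matrix m k ∧
      PresentedMonoid.mk bicyclicRel w =
        PresentedMonoid.of bicyclicRel 1 ^ m * PresentedMonoid.of bicyclicRel 0 ^ k := by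
  have hAB : PresentedMonoid.of bicyclicRel 0 * PresentedMonoid.of bicyclicRel 1 = 1 :=
    (Con.eq _).2 (ConGen.Rel.of _ _ ⟨rfl, rfl⟩)
  induction w using FreeMonoid.inductionOn' with
  | one => exact ⟨0, 0, by simp, by simp⟩
  | of_mul i w ih =>
    obtain ⟨m, k, hm, hw⟩ := ih
    have hc : matrix 0 0 * eval (FreeMonoid.of i * w) =
        ![matrix 0 1, matrix 1 0] i * matrix m k := by
      rw [map_mul, ← hm, ← mul_assoc, ← mul_assoc]
      congr 1
      fin_cases i <;> simp [eval, matrix_mul]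
    have hp : PresentedMonoid.mk bicyclicRel (FreeMonoid.of i * w) =
        PresentedMonoid.of bicyclicRel i * (PresentedMonoid.of bicyclicRel 1 ^ m *
          PresentedMonoid.of bicyclicRel 0 ^ k) := by
      rw [map_mul, hw]; rfl
    rw [hc, hp]
    fin_cases i
    · cases m with
      | zero => exact ⟨0, k + 1, by simp [matrix_mul], by simp [pow_succ']⟩
      | succ m =>
        refine ⟨m, k, by simp [matrix_mul], ?_⟩
        simp only [Fin.zero_eta]
        rw [pow_succ', ← mul_assoc, ← mul_assoc, hAB, one_mul]
    · refine ⟨m + 1, k, by simp [matrix_mul, add_comm], ?_⟩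
      simp [pow_succ', mul_assoc]

theorem eval_mul_matrix_zero (w : FreeMonoid (Fin 2)) :
    eval w * matrix 0 0 = matrix 0 0 * eval w := by
  induction w using FreeMonoid.inductionOn' with
  | one => simp
  | of_mul i w ih =>
    rw [map_mul, mul_assoc, ih, ← mul_assoc, ← mul_assoc]
    congr 1
    fin_cases i <;> simp [eval, matrix_mul]

theorem matrix_zero_mul_eval_mul (v w : FreeMonoid (Fin 2)) :
    matrix 0 0 * eval (v * w) = matrix 0 0 * eval v * (matrix 0 0 * eval w) := by
  rw [map_mul, mul_assoc (matrix 0 0) (eval v), ← mul_assoc (eval v), eval_mul_matrix_zero,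
    ← mul_assoc, ← mul_assoc, ← mul_assoc, matrix_mul]

/-- Words with the same value in `U₂(ℤ ∪ {-∞})`. -/
def evalCon : Con (FreeMonoid (Fin 2)) where
  r v w := matrix 0 0 * eval v = matrix 0 0 * eval w
  iseqv := ⟨fun _ => rfl, Eq.symm, Eq.trans⟩
  mul' h h' := by rw [matrix_zero_mul_eval_mul, h, h', ← matrix_zero_mul_eval_mul]

theorem conGen_le_evalCon : conGen bicyclicRel ≤ evalCon := by
  rw [Con.conGen_le]
  rintro _ _ ⟨rfl, rfl⟩
  change matrix 0 0 * eval _ = matrix 0 0 * eval _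
  simp [eval, matrix_mul]

/-- The embedding of the bicyclic monoid. -/
def embedding : BicyclicMonoid →ₙ* upperTriangular₂ (MaxPlus ℤ) where
  toFun x := Con.liftOn x (fun w => matrix 0 0 * eval w) fun _ _ h => conGen_le_evalCon h
  map_mul' x y := by
    induction x using PresentedMonoid.inductionOn
    induction y using PresentedMonoid.inductionOn
    exact matrix_zero_mul_eval_mul _ _

theorem embedding_mk (w : FreeMonoid (Fin 2)) :
    embedding (PresentedMonoid.mk bicyclicRel w) = matrix 0 0 * eval w := rfl

theorem embedding_injective : Function.Injective embedding := by
  intro x y h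
  induction x using PresentedMonoid.inductionOn with | _ v
  induction y using PresentedMonoid.inductionOn with | _ w
  obtain ⟨m, k, hm, hv⟩ := matrix_zero_mul_eval v
  obtain ⟨m', k', hm', hw⟩ := matrix_zero_mul_eval w
  rw [embedding_mk, embedding_mk, hm, hm'] at h
  obtain ⟨rfl, rfl⟩ := matrix_injective h
  rw [hv, hw]

theorem coe_embedding_of (i : Fin 2) :
    embedding (PresentedMonoid.of bicyclicRel i) = ![matrix 0 1, matrix 1 0] i := by
  change matrix 0 0 * eval (FreeMonoid.of i) = _
  fin_cases i <;> simp [eval, matrix_mul]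

end Bicyclic

/-! ### Occurrences of letters in words -/

namespace TropicalWords

/-- `v` is the prefix of `l` that precedes some occurrence of the letter `z`. -/
def PrecedesIn (z : ℕ) (l v : List ℕ) : Prop := ∃ r, l = v ++ z :: r

/-- The weight of a word: the sum of the weights of its letters. -/
def weight (a : ℕ → ℤ) (l : List ℕ) : ℤ := (l.map a).sum

@[simp] theorem weight_nil (a : ℕ → ℤ) : weight a [] = 0 := rfl

@[simp] theorem weight_cons (a : ℕ → ℤ) (s : ℕ) (l : List ℕ) :
    weight a (s :: l) = a s + weight a l := by simp [weight]

@[simp] theorem weight_append (a : ℕ → ℤ) (l l' : List ℕ) :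
    weight a (l ++ l') = weight a l + weight a l' := by simp [weight]

/-- Every functional used below reads off only a few letter counts; unused slots get coefficient
`0`. -/
theorem weight_eq_count (α : ℤ) (β γ δ : ℤ) (i j k : ℕ) (l : List ℕ) :
    weight (fun s => α + (if s = i then β else 0) + (if s = j then γ else 0) +
      (if s = k then δ else 0)) l =
      α * l.length + β * l.count i + γ * l.count j + δ * l.count k := by
  induction l with
  | nil => simp
  | cons s l ih =>
    rw [weight_cons, ih]
    simp only [List.length_cons, List.count_cons, beq_iff_eq]
    push_cast
    simp only [mul_add, mul_ite, mul_one, mul_zero]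
    ring

theorem precedesIn_append {z : ℕ} {l l' v : List ℕ} :
    PrecedesIn z (l ++ l') v ↔ PrecedesIn z l v ∨ ∃ v', v = l ++ v' ∧ PrecedesIn z l' v' := by
  constructor
  · rintro ⟨r, hr⟩
    rcases List.append_eq_append_iff.1 hr with ⟨c, rfl, h⟩ | ⟨c, rfl, h⟩
    · exact Or.inr ⟨c, rfl, r, h⟩
    · cases c with
      | nil => exact Or.inr ⟨[], by simp, r, by simpa using h.symm⟩
      | cons s c =>
        obtain ⟨rfl, rfl⟩ := List.cons_eq_cons.1 h
        exact Or.inl ⟨c, rfl⟩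
  · rintro (⟨r, rfl⟩ | ⟨v', rfl, r, rfl⟩)
    · exact ⟨r ++ l', by simp⟩
    · exact ⟨r, by simp⟩

theorem precedesIn_cons {z s : ℕ} {l v : List ℕ} :
    PrecedesIn z (s :: l) v ↔ (s = z ∧ v = []) ∨ ∃ v', v = s :: v' ∧ PrecedesIn z l v' := by
  cases v with
  | nil => simp [PrecedesIn]
  | cons x v =>
    simp only [PrecedesIn, List.cons_append, List.cons.injEq]
    constructor
    · rintro ⟨r, rfl, h⟩
      exact Or.inr ⟨v, ⟨rfl, rfl⟩, r, h⟩
    · rintro (⟨-, h⟩ | ⟨v', ⟨rfl, rfl⟩, r, h⟩)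
      · cases h
      · exact ⟨r, rfl, h⟩

theorem PrecedesIn.length_lt {z : ℕ} {l v : List ℕ} (h : PrecedesIn z l v) :
    v.length < l.length := by
  obtain ⟨r, rfl⟩ := h
  simp

theorem PrecedesIn.getElem? {z : ℕ} {l v : List ℕ} (h : PrecedesIn z l v) :
    l[v.length]? = some z := by
  obtain ⟨r, rfl⟩ := h
  simp

theorem PrecedesIn.unique {z : ℕ} {l v v' : List ℕ} (hl : l.Nodup) (h : PrecedesIn z l v)
    (h' : PrecedesIn z l v') : v = v' := by
  have hv : v = l.take v.length := by obtain ⟨r, rfl⟩ := h; simp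
  have hv' : v' = l.take v'.length := by obtain ⟨r, rfl⟩ := h'; simp
  have : v.length = v'.length :=
    (List.getElem?_inj h.length_lt hl).1 (h.getElem?.trans h'.getElem?.symm)
  rw [hv, hv', this]

/-- `u` and `w` have the same content, and every weighted prefix of one of them that precedes a
given letter is dominated by such a prefix of the other. -/
structure TropicallyEquiv (u w : List ℕ) : Prop where
  perm : u.Perm w
  le : ∀ (a : ℕ → ℤ) (z : ℕ) (v : List ℕ), PrecedesIn z u v →
    ∃ v', PrecedesIn z w v' ∧ weight a v ≤ weight a v'
  ge : ∀ (a : ℕ → ℤ) (z : ℕ) (v : List ℕ), PrecedesIn z w v →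
    ∃ v', PrecedesIn z u v' ∧ weight a v ≤ weight a v'

theorem TropicallyEquiv.symm {u w : List ℕ} (h : TropicallyEquiv u w) : TropicallyEquiv w u :=
  ⟨h.perm.symm, h.ge, h.le⟩

/-- The largest weight of a prefix that precedes the letter `z`. -/
def maxWeight (a : ℕ → ℤ) (z : ℕ) : List ℕ → WithBot ℤ
  | [] => ⊥
  | s :: l => max ((a s : WithBot ℤ) + maxWeight a z l) (if s = z then 0 else ⊥)

theorem le_maxWeight_iff (a : ℕ → ℤ) (z : ℕ) (l : List ℕ) (c : ℤ) :
    (c : WithBot ℤ) ≤ maxWeight a z l ↔ ∃ v, PrecedesIn z l v ∧ c ≤ weight a v := by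
  induction l generalizing c with
  | nil => simp [maxWeight, PrecedesIn]
  | cons s l ih =>
    have h1 : (c : WithBot ℤ) ≤ (a s : WithBot ℤ) + maxWeight a z l ↔
        ((c - a s : ℤ) : WithBot ℤ) ≤ maxWeight a z l := by
      cases maxWeight a z l with
      | bot => simp
      | coe m => rw [← WithBot.coe_add, WithBot.coe_le_coe, WithBot.coe_le_coe]; omega
    have h2 : (c : WithBot ℤ) ≤ (if s = z then 0 else ⊥) ↔ s = z ∧ c ≤ 0 := by
      split_ifs with h
      · simp only [h, true_and]; exact WithBot.coe_le_coe
      · simp [h]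
    rw [maxWeight, le_max_iff, h1, h2, ih]
    simp only [precedesIn_cons]
    constructor
    · rintro (⟨v, hv, h⟩ | ⟨h, h'⟩)
      · exact ⟨s :: v, Or.inr ⟨v, rfl, hv⟩, by rw [weight_cons]; omega⟩
      · exact ⟨[], Or.inl ⟨h, rfl⟩, h'⟩
    · rintro ⟨v, ⟨h, rfl⟩ | ⟨v', rfl, hv⟩, h'⟩
      · exact Or.inr ⟨h, h'⟩
      · exact Or.inl ⟨v', hv, by rw [weight_cons] at h'; omega⟩

/-- The letters of a word. -/
def letters (w : Word) : List ℕ := w.head :: w.tail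

@[simp] theorem letters_of (s : ℕ) : letters (FreeSemigroup.of s) = [s] := rfl

@[simp] theorem letters_mul (v w : Word) : letters (v * w) = letters v ++ letters w := by
  simp [letters]

theorem letters_map (θ : Word →ₙ* Word) (w : Word) :
    letters (θ w) = (letters w).flatMap fun z => letters (θ (FreeSemigroup.of z)) := by
  induction w using FreeSemigroup.recOnMul with
  | ih1 x => simp
  | ih2 x y hx hy => rw [map_mul, letters_mul, letters_mul, List.flatMap_append, hx, hy]

/-- Sends a letter `s` to the matrix with diagonal `(a s, 0)` and corner entry `0` or `-∞`
according as `s = z` or not. -/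
def evalMatrix (a : ℕ → ℤ) (z : ℕ) : Word →ₙ* upperTriangular₂ (MaxPlus ℤ) :=
  FreeSemigroup.lift fun s => upperTriangular₂.mk (MaxPlus.ofBot ((a s : ℤ) : WithBot ℤ))
    (MaxPlus.ofBot (if s = z then 0 else ⊥)) 1

/-- Only an occurrence of `z` allows the passage to row 1, after which the diagonal contributes
nothing, so each term in the corner is the weight of a prefix preceding `z`. -/
theorem evalMatrix_eq (a : ℕ → ℤ) (z : ℕ) (w : Word) :
    evalMatrix a z w = upperTriangular₂.mk (MaxPlus.ofBot (weight a (letters w) : WithBot ℤ))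
      (MaxPlus.ofBot (maxWeight a z (letters w))) 1 := by
  induction w using FreeSemigroup.recOnMul with
  | ih1 x =>
    simp [evalMatrix, maxWeight]
  | ih2 x y hx hy =>
    rw [map_mul, hy, evalMatrix, FreeSemigroup.lift_of, upperTriangular₂.mk_mul_mk, mul_one,
      mul_one, ← MaxPlus.ofBot_add, ← MaxPlus.ofBot_add, ← MaxPlus.ofBot_max, letters_mul,
      letters_of, List.singleton_append, weight_cons, WithBot.coe_add, maxWeight]

theorem tropicallyEquiv_of_satisfiesIdentity {e : SemigroupIdentity}
    (h : SatisfiesIdentity (upperTriangular₂ (MaxPlus ℤ)) e) :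
    TropicallyEquiv (letters e.1) (letters e.2) := by
  have key : ∀ a z, weight a (letters e.1) = weight a (letters e.2) ∧
      maxWeight a z (letters e.1) = maxWeight a z (letters e.2) := by
    intro a z
    have h1 := h (evalMatrix a z)
    rw [evalMatrix_eq, evalMatrix_eq] at h1
    obtain ⟨h2, h3, -⟩ := upperTriangular₂.mk_injective h1
    exact ⟨WithBot.coe_injective (MaxPlus.ofBot.injective h2), MaxPlus.ofBot.injective h3⟩
  refine ⟨?_, ?_, ?_⟩
  · rw [List.perm_iff_count]
    intro i
    have := (key (fun s => 0 + (if s = i then 1 else 0) + (if s = 0 then 0 else 0) +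
      (if s = 0 then 0 else 0)) 0).1
    rw [weight_eq_count, weight_eq_count] at this
    omega
  · intro a z v hv
    rw [← le_maxWeight_iff, ← (key a z).2, le_maxWeight_iff]
    exact ⟨v, hv, le_rfl⟩
  · intro a z v hv
    rw [← le_maxWeight_iff, (key a z).2, le_maxWeight_iff]
    exact ⟨v, hv, le_rfl⟩

/-- A prefix of `u` that is a strictly extremal point for an integral functional has a counterpart
of the same length in every equivalent word. -/
theorem TropicallyEquiv.exists_length_eq {u w : List ℕ} (h : TropicallyEquiv u w) {z : ℕ}
    {p : List ℕ} (hp : PrecedesIn z u p) (g : ℕ → ℤ)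
    (hg : ∀ q, PrecedesIn z u q → q = p ∨ weight g q + 1 ≤ weight g p) :
    w[p.length]? = some z := by
  have hlen := h.perm.length_eq
  have lin : ∀ (ε c : ℤ) (l : List ℕ),
      weight (fun s => c * g s + ε) l = c * weight g l + ε * l.length := by
    intro ε c l
    induction l with
    | nil => simp
    | cons s l ih => rw [weight_cons, ih, weight_cons, List.length_cons]; push_cast; ring
  obtain ⟨v, hv, hgv⟩ := h.le g z p hp
  have hvl := hv.length_lt
  have hpl := hp.length_lt
  -- `C` exceeds every prefix length in `u`, so in `C * g + ε` with `ε = ±1` the functional `g`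
  -- dominates and length only breaks ties. Comparing back from `w` to `u` then returns to `p`, and
  -- the two signs bound `v.length` from both sides.
  set C : ℤ := u.length + 1 with hC
  have hC0 : 0 ≤ C := by omega
  have hCv := mul_le_mul_of_nonneg_left hgv hC0
  have step : ∀ ε : ℤ, |ε| ≤ 1 → ε * (v.length : ℤ) ≤ ε * p.length ∨
      ∃ q : List ℕ, q.length < u.length ∧ ε * (v.length : ℤ) + C ≤ ε * q.length := by
    intro ε _
    obtain ⟨q, hq, hle⟩ := h.ge (fun s => C * g s + ε) z v hv
    rw [lin, lin] at hle
    rcases hg q hq with rfl | hq'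
    · left; linarith
    · right
      have := mul_le_mul_of_nonneg_left hq' hC0
      exact ⟨q, hq.length_lt, by linarith⟩
  have h1 : v.length ≤ p.length := by
    rcases step 1 (by simp) with h | ⟨q, hq, h⟩ <;> omega
  have h2 : p.length ≤ v.length := by
    rcases step (-1) (by simp) with h | ⟨q, hq, h⟩ <;> omega
  rw [le_antisymm h2 h1]
  exact hv.getElem?

/-! ### The words with the same value as `p q p p q` -/

/-- The letters of `x₁ x₂ ⋯ xₙ`. -/
def asc (n : ℕ) : List ℕ := List.range' 1 n

/-- The letters of `xₙ ⋯ x₂ x₁`. -/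
def desc (n : ℕ) : List ℕ := (asc n).reverse

/-- The letters of `p q m p q` for `p = x₁ x₂ ⋯ xₙ` and `q = xₙ ⋯ x₂ x₁`. -/
def adjanWord (n : ℕ) (m : List ℕ) : List ℕ := asc n ++ (desc n ++ (m ++ (asc n ++ desc n)))

@[simp] theorem length_asc (n : ℕ) : (asc n).length = n := by simp [asc]

@[simp] theorem length_desc (n : ℕ) : (desc n).length = n := by simp [desc]

@[simp] theorem length_adjanWord (n : ℕ) (m : List ℕ) :
    (adjanWord n m).length = m.length + 4 * n := by
  simp [adjanWord]; omega

theorem mem_asc {n i : ℕ} : i ∈ asc n ↔ 1 ≤ i ∧ i ≤ n := by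
  simp only [asc, List.mem_range'_1]; omega

theorem nodup_asc (n : ℕ) : (asc n).Nodup := List.nodup_range'

theorem perm_desc (n : ℕ) : (desc n).Perm (asc n) := List.reverse_perm _

theorem count_asc {n i : ℕ} (hi : 1 ≤ i ∧ i ≤ n) : (asc n).count i = 1 :=
  List.count_eq_one_of_mem (nodup_asc n) (mem_asc.2 hi)

theorem count_desc {n i : ℕ} (hi : 1 ≤ i ∧ i ≤ n) : (desc n).count i = 1 := by
  rw [(perm_desc n).count_eq, count_asc hi]

theorem getElem?_asc {n j : ℕ} (hj : j < n) : (asc n)[j]? = some (j + 1) := by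
  rw [asc, List.getElem?_range' hj]
  congr 1
  omega

theorem getElem?_desc {n j : ℕ} (hj : j < n) : (desc n)[j]? = some (n - j) := by
  rw [desc, List.getElem?_reverse (by simpa using hj), length_asc, getElem?_asc (by omega)]
  congr 1
  omega

theorem getElem?_adjanWord {n : ℕ} {m : List ℕ} (hm : m.length = n) {j : ℕ} (hj : j < n) :
    (adjanWord n m)[j]? = some (j + 1) ∧ (adjanWord n m)[n + j]? = some (n - j) ∧
    (adjanWord n m)[2 * n + j]? = m[j]? ∧ (adjanWord n m)[3 * n + j]? = some (j + 1) ∧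
    (adjanWord n m)[4 * n + j]? = some (n - j) := by
  have shift : ∀ (l l' : List ℕ) (k : ℕ), l.length = n → (l ++ l')[n + k]? = l'[k]? := by
    rintro l l' k rfl
    rw [List.getElem?_append_right (by omega)]
    congr 1
    omega
  have h2 : 2 * n + j = n + (n + j) := by ring
  have h3 : 3 * n + j = n + (n + (n + j)) := by ring
  have h4 : 4 * n + j = n + (n + (n + (n + j))) := by ring
  rw [h2, h3, h4, adjanWord]
  refine ⟨?_, ?_, ?_, ?_, ?_⟩
  · rw [List.getElem?_append_left (by simpa), getElem?_asc hj]
  · rw [shift _ _ _ (by simp), List.getElem?_append_left (by simpa), getElem?_desc hj]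
  · rw [shift _ _ _ (by simp), shift _ _ _ (by simp), List.getElem?_append_left (by omega)]
  · rw [shift _ _ _ (by simp), shift _ _ _ (by simp), shift _ _ _ hm,
      List.getElem?_append_left (by simpa), getElem?_asc hj]
  · rw [shift _ _ _ (by simp), shift _ _ _ (by simp), shift _ _ _ hm, shift _ _ _ (by simp),
      getElem?_desc hj]

/-- The letters `x₁ ⋯ xᵢ₋₁`. -/
def below (i : ℕ) : List ℕ := List.range' 1 (i - 1)

/-- The letters `xₙ ⋯ xᵢ₊₁`. -/
def above (n i : ℕ) : List ℕ := (List.range' (i + 1) (n - i)).reverse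

@[simp] theorem length_below (i : ℕ) : (below i).length = i - 1 := by simp [below]

@[simp] theorem length_above (n i : ℕ) : (above n i).length = n - i := by simp [above]

theorem count_below {i r : ℕ} (hr : 1 ≤ r) : (below i).count r = if r < i then 1 else 0 := by
  rw [below, List.count_range']
  refine if_congr ⟨?_, fun h => ⟨r - 1, by omega, by omega⟩⟩ rfl rfl
  rintro ⟨j, hj, rfl⟩
  omega

theorem count_above {n i r : ℕ} (hr : r ≤ n) : (above n i).count r = if i < r then 1 else 0 := by
  rw [above, List.count_reverse, List.count_range']
  refine if_congr ⟨?_, fun h => ⟨r - (i + 1), by omega, by omega⟩⟩ rfl rfl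
  rintro ⟨j, hj, rfl⟩
  omega

theorem asc_eq {n i : ℕ} (hi : 1 ≤ i ∧ i ≤ n) :
    asc n = below i ++ i :: List.range' (i + 1) (n - i) := by
  have h := List.range'_append (s := 1) (m := i - 1) (n := n - i + 1) (step := 1)
  rw [List.range'_succ] at h
  rw [asc, below, ← (by omega : i - 1 + (n - i + 1) = n), ← h]
  congr 2
  · omega
  · congr 1 <;> omega

theorem precedesIn_asc {n i : ℕ} (hi : 1 ≤ i ∧ i ≤ n) {v : List ℕ} :
    PrecedesIn i (asc n) v ↔ v = below i := by
  have h : PrecedesIn i (asc n) (below i) := ⟨_, asc_eq hi⟩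
  exact ⟨fun hv => hv.unique (nodup_asc n) h, fun hv => hv ▸ h⟩

theorem precedesIn_desc {n i : ℕ} (hi : 1 ≤ i ∧ i ≤ n) {v : List ℕ} :
    PrecedesIn i (desc n) v ↔ v = above n i := by
  have h : PrecedesIn i (desc n) (above n i) :=
    ⟨(below i).reverse, by rw [desc, asc_eq hi]; simp [above]⟩
  exact ⟨fun hv => hv.unique (List.nodup_reverse.2 (nodup_asc n)) h, fun hv => hv ▸ h⟩

theorem precedesIn_adjanWord_asc {n i : ℕ} (hi : 1 ≤ i ∧ i ≤ n) {v : List ℕ} :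
    PrecedesIn i (adjanWord n (asc n)) v ↔ v = below i ∨ v = asc n ++ above n i ∨
      v = asc n ++ (desc n ++ below i) ∨ v = asc n ++ (desc n ++ (asc n ++ below i)) ∨
      v = asc n ++ (desc n ++ (asc n ++ (asc n ++ above n i))) := by
  simp only [adjanWord, precedesIn_append, precedesIn_asc hi, precedesIn_desc hi]
  constructor
  · rintro (h | ⟨_, rfl, h | ⟨_, rfl, h | ⟨_, rfl, h | ⟨_, rfl, h⟩⟩⟩⟩) <;> simp [h]
  · rintro (h | h | h | h | h) <;> simp [h]

/-- The counts of `(i, r)` in the five prefixes preceding `i` are `(0,1), (1,1), (2,3), (3,4),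
(4,4)` if `r < i`, and `(0,0), (1,2), (2,2), (3,3), (4,5)` if `i < r`. All but the third are
vertices of the convex hull, exposed by the functionals `l, κ` chosen below; the third lies on the
edge joining the first and the fourth. -/
theorem TropicallyEquiv.getElem?_eq {n : ℕ} (hn : 2 ≤ n) {w : List ℕ}
    (h : TropicallyEquiv (adjanWord n (asc n)) w) {i : ℕ} (hi : 1 ≤ i ∧ i ≤ n) :
    w[i - 1]? = some i ∧ w[n + (n - i)]? = some i ∧ w[3 * n + (i - 1)]? = some i ∧
      w[4 * n + (n - i)]? = some i := by
  obtain ⟨r, hr, hri⟩ : ∃ r, (1 ≤ r ∧ r ≤ n) ∧ r ≠ i := by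
    rcases eq_or_ne i 1 with rfl | h1
    · exact ⟨2, by omega, by omega⟩
    · exact ⟨1, by omega, h1.symm⟩
  have H := @precedesIn_adjanWord_asc n i hi
  have key : ∀ (l κ : ℤ) (p : List ℕ), PrecedesIn i (adjanWord n (asc n)) p →
      (∀ q, PrecedesIn i (adjanWord n (asc n)) q →
        q = p ∨ l * q.count i + κ * q.count r + 1 ≤ l * p.count i + κ * p.count r) →
      w[p.length]? = some i := by
    intro l κ p hp hq
    refine h.exists_length_eq hp (fun s => 0 + (if s = i then l else 0) +
      (if s = r then κ else 0) + (if s = r then 0 else 0)) fun q hq' => ?_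
    rw [weight_eq_count, weight_eq_count]
    simpa using hq q hq'
  have c1 := count_asc hi
  have c2 := count_asc hr
  have c3 := count_desc hi
  have c4 := count_desc hr
  have c5 := @count_below i i hi.1
  have c6 := @count_below i r hr.1
  have c7 := @count_above n i i hi.2
  have c8 := @count_above n i r hr.2
  rw [if_neg (lt_irrefl i)] at c5 c7
  rcases lt_or_gt_of_ne hri with hlt | hlt
  · rw [if_pos hlt] at c6
    rw [if_neg hlt.le.not_gt] at c8
    refine ⟨?_, ?_, ?_, ?_⟩
    · have := key (-1) 0 _ (H.2 (Or.inl rfl)) fun q hq => by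
        rcases H.1 hq with rfl | rfl | rfl | rfl | rfl <;>
          simp [List.count_append, c1, c2, c3, c4, c5, c6, c7, c8]
      simpa using this
    · have := key 1 (-2) _ (H.2 (Or.inr (Or.inl rfl))) fun q hq => by
        rcases H.1 hq with rfl | rfl | rfl | rfl | rfl <;>
          simp [List.count_append, c1, c2, c3, c4, c5, c6, c7, c8]
      simpa using this
    · have := key (-1) 2 _ (H.2 (Or.inr (Or.inr (Or.inr (Or.inl rfl))))) fun q hq => by
        rcases H.1 hq with rfl | rfl | rfl | rfl | rfl <;>
          simp [List.count_append, c1, c2, c3, c4, c5, c6, c7, c8]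
      rw [← this]; congr 1; simp; omega
    · have := key 1 0 _ (H.2 (Or.inr (Or.inr (Or.inr (Or.inr rfl))))) fun q hq => by
        rcases H.1 hq with rfl | rfl | rfl | rfl | rfl <;>
          simp [List.count_append, c1, c2, c3, c4, c5, c6, c7, c8]
      rw [← this]; congr 1; simp; omega
  · rw [if_neg hlt.le.not_gt] at c6
    rw [if_pos hlt] at c8
    refine ⟨?_, ?_, ?_, ?_⟩
    · have := key (-1) 0 _ (H.2 (Or.inl rfl)) fun q hq => by
        rcases H.1 hq with rfl | rfl | rfl | rfl | rfl <;>
          simp [List.count_append, c1, c2, c3, c4, c5, c6, c7, c8]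
      simpa using this
    · have := key (-3) 2 _ (H.2 (Or.inr (Or.inl rfl))) fun q hq => by
        rcases H.1 hq with rfl | rfl | rfl | rfl | rfl <;>
          simp [List.count_append, c1, c2, c3, c4, c5, c6, c7, c8]
      simpa using this
    · have := key 3 (-2) _ (H.2 (Or.inr (Or.inr (Or.inr (Or.inl rfl))))) fun q hq => by
        rcases H.1 hq with rfl | rfl | rfl | rfl | rfl <;>
          simp [List.count_append, c1, c2, c3, c4, c5, c6, c7, c8]
      rw [← this]; congr 1; simp; omega
    · have := key 1 0 _ (H.2 (Or.inr (Or.inr (Or.inr (Or.inr rfl))))) fun q hq => by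
        rcases H.1 hq with rfl | rfl | rfl | rfl | rfl <;>
          simp [List.count_append, c1, c2, c3, c4, c5, c6, c7, c8]
      rw [← this]; congr 1; simp; omega

theorem TropicallyEquiv.exists_eq_adjanWord {n : ℕ} (hn : 2 ≤ n) {w : List ℕ}
    (h : TropicallyEquiv (adjanWord n (asc n)) w) : ∃ m, m.Perm (asc n) ∧ w = adjanWord n m := by
  have hlen : w.length = 5 * n := by
    rw [← h.perm.length_eq, length_adjanWord, length_asc]; omega
  have hm : ((w.drop (2 * n)).take n).length = n := by simp; omega
  have hw : w = adjanWord n ((w.drop (2 * n)).take n) := by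
    apply List.ext_getElem?
    have cover : ∀ j, (∃ b < 5, ∃ k < n, j = b * n + k) ∨ 5 * n ≤ j := by
      intro j
      by_cases hj : j < 5 * n
      · exact Or.inl ⟨j / n, (Nat.div_lt_iff_lt_mul (by omega)).2 hj, j % n,
          Nat.mod_lt _ (by omega), (Nat.div_add_mod' j n).symm⟩
      · exact Or.inr (by omega)
    intro j
    rcases cover j with ⟨b, hb, k, hk, rfl⟩ | hj
    · obtain ⟨a0, a1, a2, a3, a4⟩ := getElem?_adjanWord hm hk
      obtain ⟨b0, -, b3, -⟩ := h.getElem?_eq hn (i := k + 1) (by omega)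
      obtain ⟨-, b1, -, b4⟩ := h.getElem?_eq hn (i := n - k) (by omega)
      rw [Nat.add_sub_cancel] at b0 b3
      rw [Nat.sub_sub_self hk.le] at b1 b4
      interval_cases b
      · rw [zero_mul, zero_add, a0, b0]
      · rw [one_mul, a1, b1]
      · rw [a2, List.getElem?_take_of_lt hk, List.getElem?_drop]
      · rw [a3, b3]
      · rw [a4, b4]
    · rw [List.getElem?_eq_none (by omega), List.getElem?_eq_none (by simp; omega)]
  refine ⟨_, ?_, hw⟩
  have hp := h.perm
  rw [hw, adjanWord, adjanWord, List.perm_append_left_iff, List.perm_append_left_iff,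
    List.perm_append_right_iff] at hp
  exact hp.symm

/-- The functional `-2 xᵢ + xᵣ + xₛ` equals `1` on all five prefixes preceding `i` in `p q p p q`.
Using it with both signs forces the same value in the middle block: exactly one of `r` and `s`
precedes `i` there. -/
theorem TropicallyEquiv.count_add_count {n : ℕ} {m : List ℕ}
    (h : TropicallyEquiv (adjanWord n (asc n)) (adjanWord n m)) (hm : m.Nodup) {i r s : ℕ}
    (hi : 1 ≤ i) (hri : 1 ≤ r ∧ r < i) (his : i < s ∧ s ≤ n) {v : List ℕ}
    (hv : PrecedesIn i m v) : v.count r + v.count s = 1 := by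
  have hin : 1 ≤ i ∧ i ≤ n := by omega
  have hr : 1 ≤ r ∧ r ≤ n := by omega
  have hs : 1 ≤ s ∧ s ≤ n := by omega
  have hvi : v.count i = 0 := by
    obtain ⟨t, rfl⟩ := hv
    rw [List.count_eq_zero]
    intro hmem
    exact (List.nodup_append.1 hm).2.2 i hmem i (by simp) rfl
  have hp : PrecedesIn i (adjanWord n m) (asc n ++ (desc n ++ v)) := by
    rw [adjanWord]
    exact precedesIn_append.2 (Or.inr ⟨_, rfl, precedesIn_append.2
      (Or.inr ⟨_, rfl, precedesIn_append.2 (Or.inl hv)⟩)⟩)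
  have key : ∀ κ : ℤ, κ * (v.count r + v.count s) ≤ κ := by
    intro κ
    obtain ⟨q, hq, hle⟩ := h.ge (fun x => 0 + (if x = i then -2 * κ else 0) +
      (if x = r then κ else 0) + (if x = s then κ else 0)) i _ hp
    rw [weight_eq_count, weight_eq_count] at hle
    have h1 : ¬ i < r := by omega
    have h2 : ¬ s < i := by omega
    rcases (precedesIn_adjanWord_asc hin).1 hq with rfl | rfl | rfl | rfl | rfl <;>
      simp [List.count_append, count_asc, count_desc, count_below, count_above, hin, hr, hs,
        hri.2, his.1, h1, h2, hvi] at hle <;>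
      linarith
  have h1 := key 1
  have h2 := key (-1)
  omega

theorem TropicallyEquiv.eq_or_eq {n : ℕ} (hn : 2 ≤ n) {w : List ℕ}
    (h : TropicallyEquiv (adjanWord n (asc n)) w) :
    w = adjanWord n (asc n) ∨ w = adjanWord n (desc n) := by
  obtain ⟨m, hm, rfl⟩ := h.exists_eq_adjanWord hn
  have hnd : m.Nodup := hm.nodup_iff.2 (nodup_asc n)
  have hmem : ∀ i, i ∈ m ↔ 1 ≤ i ∧ i ≤ n := fun i => hm.mem_iff.trans mem_asc
  have hcount : ∀ {i r s : ℕ}, 1 ≤ r → r < i → i < s → s ≤ n → ∀ {v}, PrecedesIn i m v →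
      v.count r + v.count s = 1 := fun hr hri his hs _ hv =>
    h.count_add_count hnd (by omega) ⟨hr, hri⟩ ⟨his, hs⟩ hv
  obtain ⟨x, m', rfl⟩ : ∃ x m', m = x :: m' :=
    List.exists_cons_of_ne_nil (List.ne_nil_of_mem ((hmem 1).2 (by omega)))
  obtain ⟨hx1, hxn⟩ := (hmem x).1 (by simp)
  have hxm := (List.nodup_cons.1 hnd).1
  have hnd' := (List.nodup_cons.1 hnd).2
  -- A letter `r` strictly between the first letter `x` and an earlier letter `s` would have both of
  -- them before it. So starting from an extreme letter, the block is monotone.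
  have hbad : ∀ l₁ l₂ s r, m' = l₁ ++ s :: l₂ → r ∈ l₂ →
      s ≠ r ∧ ¬ (x < r ∧ r < s) ∧ ¬ (s < r ∧ r < x) := by
    intro l₁ l₂ s r hs hr
    have hsn := (hmem s).1 (by simp [hs])
    have hsr : s ≠ r := by
      rintro rfl
      rw [hs] at hnd'
      exact (List.nodup_cons.1 (List.nodup_append.1 hnd').2.1).1 hr
    obtain ⟨t, t', rfl⟩ := List.append_of_mem hr
    have hv : PrecedesIn r (x :: m') (x :: (l₁ ++ s :: t)) := ⟨t', by simp [hs]⟩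
    have hcx : 1 ≤ (x :: (l₁ ++ s :: t)).count x := List.count_pos_iff.2 (by simp)
    have hcs : 1 ≤ (x :: (l₁ ++ s :: t)).count s := List.count_pos_iff.2 (by simp)
    refine ⟨hsr, fun hlt => ?_, fun hlt => ?_⟩
    · have := hcount hx1 hlt.1 hlt.2 hsn.2 hv
      omega
    · have := hcount hsn.1 hlt.1 hlt.2 hxn hv
      omega
  have hpair : ∀ {R : ℕ → ℕ → Prop}, (∀ l₁ l₂ s, m' = l₁ ++ s :: l₂ → ∀ r ∈ l₂, R s r) →
      m'.Pairwise R := by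
    intro R
    generalize m' = l
    induction l with
    | nil => intro _; exact List.Pairwise.nil
    | cons a l ih =>
      intro hR
      refine List.pairwise_cons.2 ⟨hR [] l a rfl, ih fun l₁ l₂ s hs => hR (a :: l₁) l₂ s ?_⟩
      rw [hs, List.cons_append]
  have hne : ∀ r ∈ m', r ≠ x := fun r hr h => hxm (h ▸ hr)
  have hbd : ∀ r ∈ m', 1 ≤ r ∧ r ≤ n := fun r hr => (hmem r).1 (by simp [hr])
  rcases (by omega : x = 1 ∨ x = n ∨ (1 < x ∧ x < n)) with hx | hx | hx
  · left
    congr 1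
    refine hm.eq_of_pairwise (le := (· < ·)) (fun a b _ _ h h' => absurd h h'.not_gt) ?_
      (List.pairwise_lt_range' 1)
    refine List.pairwise_cons.2 ⟨fun r hr => ?_, hpair fun l₁ l₂ s hs r hr => ?_⟩
    · have := hne r hr
      have := hbd r hr
      omega
    · have hrm : r ∈ m' := by simp [hs, hr]
      have := hbad l₁ l₂ s r hs hr
      have := hne r hrm
      have := hbd r hrm
      omega
  · right
    congr 1
    refine (hm.trans (perm_desc n).symm).eq_of_pairwise (le := (· > ·))
      (fun a b _ _ h h' => absurd h h'.not_gt) ?_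
      (List.pairwise_reverse.2 (List.pairwise_lt_range' 1))
    refine List.pairwise_cons.2 ⟨fun r hr => ?_, hpair fun l₁ l₂ s hs r hr => ?_⟩
    · have := hne r hr
      have := hbd r hr
      omega
    · have hrm : r ∈ m' := by simp [hs, hr]
      have := hbad l₁ l₂ s r hs hr
      have := hne r hrm
      have := hbd r hrm
      omega
  · have := hcount le_rfl hx.1 hx.2 le_rfl (v := []) ⟨m', rfl⟩
    simp at this

/-! ### Short identities do not apply to `p q p p q` -/

theorem length_flatMap_eq_weight (f : ℕ → List ℕ) (l : List ℕ) :
    ((l.flatMap f).length : ℤ) = weight (fun z => ((f z).length : ℤ)) l := by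
  induction l with
  | nil => simp
  | cons s l ih => rw [List.flatMap_cons, List.length_append, weight_cons, ← ih, Nat.cast_add]

/-- If the images of the letters of `s` cover an interval of more than `s.length` positions, then
the image of one letter covers two consecutive positions. -/
theorem exists_precedesIn_cover (f : ℕ → List ℕ) (s : List ℕ) (A X : ℕ) (hA : A ≤ X)
    (hX : X + s.length < A + (s.flatMap f).length) :
    ∃ y v Z, PrecedesIn y s v ∧ X ≤ Z ∧ Z + 1 ≤ X + s.length ∧
      A + (v.flatMap f).length ≤ Z ∧ Z + 1 < A + (v.flatMap f).length + (f y).length := by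
  induction s generalizing A X with
  | nil => simp at hX; omega
  | cons y s ih =>
    simp only [List.flatMap_cons, List.length_append, List.length_cons] at hX ⊢
    by_cases h : X + 1 < A + (f y).length
    · exact ⟨y, [], X, ⟨s, rfl⟩, le_rfl, by omega, by simpa, by simpa⟩
    · obtain ⟨y', v, Z, ⟨r, rfl⟩, h1, h2, h3, h4⟩ : ∃ y' v Z, PrecedesIn y' s v ∧ X ≤ Z ∧
          Z + 1 ≤ X + 1 + s.length ∧ A + (f y).length + (v.flatMap f).length ≤ Z ∧
          Z + 1 < A + (f y).length + (v.flatMap f).length + (f y').length := by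
        -- Either the image of `y` ends before position `X` and is discarded, or it ends exactly
        -- there, and then one letter pays for one position.
        by_cases h' : A + (f y).length ≤ X
        · obtain ⟨y', v, Z, hv, h1, h2, h3, h4⟩ := ih (A + (f y).length) X h' (by omega)
          exact ⟨y', v, Z, hv, h1, by omega, h3, h4⟩
        · obtain ⟨y', v, Z, hv, h1, h2, h3, h4⟩ := ih (A + (f y).length) (X + 1) (by omega) (by omega)
          exact ⟨y', v, Z, hv, by omega, by omega, h3, h4⟩
      exact ⟨y', y :: v, Z, ⟨r, rfl⟩, by omega, by omega, by simpa [add_assoc] using h3,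
        by simpa [add_assoc] using h4⟩

theorem getElem?_flatMap_of_precedesIn {f : ℕ → List ℕ} {y : ℕ} {t v : List ℕ}
    (hv : PrecedesIn y t v) (a b : List ℕ) {c : ℕ} (hc : c < (f y).length) :
    (a ++ t.flatMap f ++ b)[a.length + (v.flatMap f).length + c]? = (f y)[c]? := by
  obtain ⟨r, rfl⟩ := hv
  rw [List.flatMap_append, List.flatMap_cons]
  have : a ++ (v.flatMap f ++ (f y ++ r.flatMap f)) ++ b =
      (a ++ v.flatMap f) ++ (f y ++ (r.flatMap f ++ b)) := by simp
  rw [this, List.getElem?_append_right (by simp), List.getElem?_append_left (by simp; omega)]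
  congr 1
  simp

/-- Prefixes preceding the first three occurrences of a letter. -/
theorem exists_three_precedesIn {y : ℕ} {l : List ℕ} (h : 3 ≤ l.count y) (f : ℕ → List ℕ)
    (hf : f y ≠ []) : ∃ v₁ v₂ v₃, PrecedesIn y l v₁ ∧ PrecedesIn y l v₂ ∧ PrecedesIn y l v₃ ∧
      (v₁.flatMap f).length < (v₂.flatMap f).length ∧
      (v₂.flatMap f).length < (v₃.flatMap f).length := by
  have hpos : 0 < (f y).length := List.length_pos_iff.2 hf
  rw [← List.replicate_sublist_iff] at h
  obtain ⟨l₁, l', rfl, h1, h⟩ := List.cons_sublist_iff.1 h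
  obtain ⟨l₂, l₃, rfl, h2, h⟩ := List.cons_sublist_iff.1 h
  have h3 : y ∈ l₃ := h.subset (by simp)
  obtain ⟨a₁, b₁, rfl⟩ := List.append_of_mem h1
  obtain ⟨a₂, b₂, rfl⟩ := List.append_of_mem h2
  obtain ⟨a₃, b₃, rfl⟩ := List.append_of_mem h3
  exact ⟨a₁, a₁ ++ y :: b₁ ++ a₂, a₁ ++ y :: b₁ ++ a₂ ++ y :: b₂ ++ a₃,
    ⟨_, by simp; rfl⟩, ⟨_, by simp; rfl⟩, ⟨b₃, by simp⟩, by simp; omega, by simp; omega⟩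

/-- A letter with three prefixes of different lengths occurs at least three times. -/
theorem three_le_count {y : ℕ} {l v₁ v₂ v₃ : List ℕ} (h₁ : PrecedesIn y l v₁)
    (h₂ : PrecedesIn y l v₂) (h₃ : PrecedesIn y l v₃) (h₁₂ : v₁.length < v₂.length)
    (h₂₃ : v₂.length < v₃.length) : 3 ≤ l.count y := by
  have step : ∀ {v v' : List ℕ}, PrecedesIn y l v → PrecedesIn y l v' → v.length < v'.length →
      v.count y + 1 ≤ v'.count y := by
    rintro v v' ⟨r, hr⟩ ⟨r', hr'⟩ hlt
    have hp : v ++ [y] <+: v' := by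
      refine List.prefix_of_prefix_length_le (l₃ := l) ⟨r, by simp [hr]⟩ ⟨y :: r', hr'.symm⟩ ?_
      simpa using hlt
    simpa using hp.sublist.count_le y
  have e1 := step h₁ h₂ h₁₂
  have e2 := step h₂ h₃ h₂₃
  obtain ⟨r, rfl⟩ := h₃
  rw [List.count_append, List.count_cons_self]
  omega

theorem adjanWord_asc_ne_desc {n : ℕ} (hn : 2 ≤ n) :
    adjanWord n (asc n) ≠ adjanWord n (desc n) := by
  intro h
  have h1 := (getElem?_adjanWord (n := n) (length_asc n) (j := 0) (by omega)).2.2.1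
  have h2 := (getElem?_adjanWord (n := n) (length_desc n) (j := 0) (by omega)).2.2.1
  rw [h, h2, getElem?_asc (by omega), getElem?_desc (by omega)] at h1
  simp at h1
  omega

/-- The factor `xⱼ₊₁ xⱼ₊₂` occurs in `p q q p q` only in the two factors `p`. -/
theorem eq_or_eq_of_getElem?_adjanWord_desc {n j k : ℕ} (hn : 3 ≤ n) (hj : j + 1 < n)
    (h1 : (adjanWord n (desc n))[k]? = some (j + 1))
    (h2 : (adjanWord n (desc n))[k + 1]? = some (j + 2)) : k = j ∨ k = 3 * n + j := by
  have hk : k + 1 < 5 * n := by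
    have := (List.getElem?_eq_some_iff.1 h2).1
    simp at this
    omega
  obtain ⟨b, hb, i, hi, rfl⟩ : ∃ b < 5, ∃ i < n, k = b * n + i :=
    ⟨k / n, (Nat.div_lt_iff_lt_mul (by omega)).2 (by omega), k % n,
      Nat.mod_lt _ (by omega), (Nat.div_add_mod' k n).symm⟩
  obtain ⟨a0, a1, a2, a3, a4⟩ := getElem?_adjanWord (length_desc n) hi
  rw [getElem?_desc hi] at a2
  by_cases hi' : i + 1 < n
  · obtain ⟨b0, b1, b2, b3, b4⟩ := getElem?_adjanWord (length_desc n) hi'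
    rw [getElem?_desc hi'] at b2
    simp only [← add_assoc] at b0 b1 b2 b3 b4
    interval_cases b <;> try simp only [zero_mul, zero_add, one_mul] at h1 h2 ⊢
    · rw [a0] at h1; simp at h1; omega
    · rw [a1] at h1; rw [b1] at h2; simp at h1 h2; omega
    · rw [a2] at h1; rw [b2] at h2; simp at h1 h2; omega
    · rw [a3] at h1; simp at h1; omega
    · rw [a4] at h1; rw [b4] at h2; simp at h1 h2; omega
  -- Here the factor straddles two blocks. The boundary of `q q` reads `x₁ xₙ`, which is excluded
  -- because `n ≥ 3`.
  · obtain rfl : n = i + 1 := by omega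
    obtain ⟨b0, b1, b2, b3, b4⟩ := getElem?_adjanWord (length_desc (i + 1)) (Nat.succ_pos i)
    rw [getElem?_desc (Nat.succ_pos i)] at b2
    have e1 : 1 * (i + 1) + i + 1 = 2 * (i + 1) + 0 := by ring
    have e2 : 2 * (i + 1) + i + 1 = 3 * (i + 1) + 0 := by ring
    have e3 : 3 * (i + 1) + i + 1 = 4 * (i + 1) + 0 := by ring
    have e0 : 0 * (i + 1) + i + 1 = (i + 1) + 0 := by ring
    interval_cases b
    · rw [e0, b1] at h2; rw [zero_mul, zero_add, a0] at h1; simp at h1 h2; omega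
    · rw [e1, b2] at h2; rw [one_mul, a1] at h1; simp at h1 h2; omega
    · rw [e2, b3] at h2; simp at h2
    · rw [e3, b4] at h2; rw [a3] at h1; simp at h1 h2; omega
    · omega

theorem TropicallyEquiv.not_substitution {n : ℕ} (hn : 3 ≤ n) {s t : List ℕ}
    (h : TropicallyEquiv s t) (hs : s.length < n) (f : ℕ → List ℕ) (hf : ∀ z, f z ≠ [])
    (a b : List ℕ) (hu : a ++ s.flatMap f ++ b = adjanWord n (asc n))
    (hv : a ++ t.flatMap f ++ b = adjanWord n (desc n)) : False := by
  have hlu := congrArg List.length hu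
  have hlv := congrArg List.length hv
  simp only [List.length_append, length_adjanWord, length_asc, length_desc] at hlu hlv
  -- The words differ at both ends of the middle block, so neither context can reach into it: the
  -- substituted part covers all its `n` positions.
  have ha : a.length ≤ 2 * n := by
    by_contra hlt
    have h1 := (getElem?_adjanWord (n := n) (length_asc n) (j := 0) (by omega)).2.2.1
    have h2 := (getElem?_adjanWord (n := n) (length_desc n) (j := 0) (by omega)).2.2.1
    rw [← hu, List.append_assoc, List.getElem?_append_left (by omega),
      getElem?_asc (by omega)] at h1
    rw [← hv, List.append_assoc, List.getElem?_append_left (by omega),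
      getElem?_desc (by omega), h1] at h2
    simp at h2
    omega
  have hb : b.length ≤ 2 * n := by
    by_contra hlt
    have h1 := (getElem?_adjanWord (n := n) (length_asc n) (j := n - 1) (by omega)).2.2.1
    have h2 := (getElem?_adjanWord (n := n) (length_desc n) (j := n - 1) (by omega)).2.2.1
    rw [← hu, List.getElem?_append_right (by rw [List.length_append]; omega), getElem?_asc (by omega)] at h1
    rw [← hv, List.getElem?_append_right (by rw [List.length_append]; omega), getElem?_desc (by omega)] at h2
    have e : (a ++ s.flatMap f).length = (a ++ t.flatMap f).length := by
      rw [List.length_append, List.length_append]; omega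
    rw [← e, h1] at h2
    simp at h2
    omega
  obtain ⟨y, v, Z, hyv, hZ1, hZ2, hZ3, hZ4⟩ :=
    exists_precedesIn_cover f s a.length (2 * n) ha (by omega)
  obtain ⟨c, rfl⟩ := Nat.exists_eq_add_of_le hZ3
  obtain ⟨j, hj⟩ := Nat.exists_eq_add_of_le hZ1
  have hjn : j + 1 < n := by omega
  have hc1 : (f y)[c]? = some (j + 1) := by
    rw [← getElem?_flatMap_of_precedesIn hyv a b (by omega), hu, hj,
      (getElem?_adjanWord (length_asc n) (by omega)).2.2.1, getElem?_asc (by omega)]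
  have hc2 : (f y)[c + 1]? = some (j + 2) := by
    rw [← getElem?_flatMap_of_precedesIn hyv a b (by omega), hu, ← add_assoc, hj, add_assoc,
      (getElem?_adjanWord (length_asc n) (by omega)).2.2.1, getElem?_asc (by omega)]
  have pos : ∀ v', PrecedesIn y t v' → a.length + (v'.flatMap f).length + c = j ∨
      a.length + (v'.flatMap f).length + c = 3 * n + j := by
    intro v' hv'
    refine eq_or_eq_of_getElem?_adjanWord_desc hn hjn ?_ ?_
    · rw [← hv, getElem?_flatMap_of_precedesIn hv' a b (by omega), hc1]
    · rw [← hv, add_assoc, getElem?_flatMap_of_precedesIn hv' a b (by omega), hc2]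
  have lenW := length_flatMap_eq_weight f
  have negW : ∀ l, -((l.flatMap f).length : ℤ) = weight (fun z => -((f z).length : ℤ)) l := by
    intro l
    induction l with
    | nil => simp
    | cons z l ih =>
      rw [List.flatMap_cons, List.length_append, weight_cons, ← ih]
      push_cast
      ring
  -- Weighting letters by plus or minus their image lengths compares positions of `y` in the two
  -- words.
  have up : ∀ {s t : List ℕ}, TropicallyEquiv s t → ∀ v, PrecedesIn y s v →
      (∃ v', PrecedesIn y t v' ∧ (v.flatMap f).length ≤ (v'.flatMap f).length) ∧
      (∃ v', PrecedesIn y t v' ∧ (v'.flatMap f).length ≤ (v.flatMap f).length) := by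
    intro s t h v hv
    obtain ⟨v₁, hv₁, h₁⟩ := h.le (fun z => ((f z).length : ℤ)) y v hv
    obtain ⟨v₂, hv₂, h₂⟩ := h.le (fun z => -((f z).length : ℤ)) y v hv
    rw [← lenW, ← lenW] at h₁
    rw [← negW, ← negW] at h₂
    exact ⟨⟨v₁, hv₁, by omega⟩, ⟨v₂, hv₂, by omega⟩⟩
  obtain ⟨⟨t₃, ht₃, hle₃⟩, ⟨t₁, ht₁, hle₁⟩⟩ := up h v hyv
  obtain ⟨⟨s₃, hs₃, hle₃'⟩, -⟩ := up h.symm t₃ ht₃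
  obtain ⟨-, ⟨s₁, hs₁, hle₁'⟩⟩ := up h.symm t₁ ht₁
  have p₃ := pos t₃ ht₃
  have p₁ := pos t₁ ht₁
  have mono : ∀ {v v' : List ℕ}, PrecedesIn y s v → PrecedesIn y s v' →
      (v.flatMap f).length < (v'.flatMap f).length → v.length < v'.length := by
    rintro v v' ⟨r, hr⟩ ⟨r', hr'⟩ hlt
    by_contra hge
    have hp : v' <+: v :=
      List.prefix_of_prefix_length_le (l₃ := s) ⟨_, hr'.symm⟩ ⟨_, hr.symm⟩ (by omega)
    obtain ⟨d, rfl⟩ := hp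
    rw [List.flatMap_append, List.length_append] at hlt
    omega
  -- In `t` the factor sits in the first or the fourth block. Transferred back to `s`, these
  -- positions give occurrences of `y` strictly before and strictly after the one in the middle
  -- block.
  have hcount := three_le_count hs₁ hyv hs₃ (mono hs₁ hyv (by omega)) (mono hyv hs₃ (by omega))
  rw [h.perm.count_eq] at hcount
  obtain ⟨v₁, v₂, v₃, h₁, h₂, h₃, h₁₂, h₂₃⟩ := exists_three_precedesIn hcount f (hf y)
  have := pos v₁ h₁
  have := pos v₂ h₂
  have := pos v₃ h₃
  omega

/-! ### The nonfinite basis property -/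

theorem letters_ascWord (k : ℕ) : letters (ascWord k) = asc (k + 1) := by
  induction k with
  | zero => rfl
  | succ k ih =>
    rw [ascWord, letters_mul, ih, letters_of, asc, asc, List.range'_concat (n := k + 1)]
    congr 2
    omega

theorem letters_descWord (k : ℕ) : letters (descWord k) = desc (k + 1) := by
  induction k with
  | zero => rfl
  | succ k ih =>
    rw [descWord, letters_mul, ih, letters_of, desc, desc, asc, asc,
      List.range'_concat (n := k + 1), List.reverse_append]
    congr 2
    simp
    omega

theorem letters_adjanIdentity (k : ℕ) :
    letters (adjanIdentity k).1 = adjanWord (k + 1) (asc (k + 1)) ∧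
      letters (adjanIdentity k).2 = adjanWord (k + 1) (desc (k + 1)) := by
  simp [adjanIdentity, adjanWord, letters_ascWord, letters_descWord]

/-- Equivalence is compatible with contexts. -/
theorem TropicallyEquiv.append {s t : List ℕ} (h : TropicallyEquiv s t) (a b : List ℕ) :
    TropicallyEquiv (a ++ s ++ b) (a ++ t ++ b) := by
  have key : ∀ {s t : List ℕ}, TropicallyEquiv s t → ∀ (c : ℕ → ℤ) z v,
      PrecedesIn z (a ++ s ++ b) v →
      ∃ v', PrecedesIn z (a ++ t ++ b) v' ∧ weight c v ≤ weight c v' := by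
    intro s t h c z v hv
    rw [precedesIn_append, precedesIn_append] at hv
    simp only [precedesIn_append]
    rcases hv with (hv | ⟨v', rfl, hv⟩) | ⟨v', rfl, hv⟩
    · exact ⟨v, Or.inl (Or.inl hv), le_rfl⟩
    · obtain ⟨v'', hv'', hle⟩ := h.le c z v' hv
      exact ⟨a ++ v'', Or.inl (Or.inr ⟨v'', rfl, hv''⟩), by simpa⟩
    · refine ⟨a ++ t ++ v', Or.inr ⟨v', rfl, hv⟩, ?_⟩
      have : weight c s = weight c t := (h.perm.map c).sum_eq
      simp [this]
  exact ⟨(h.perm.append_left a).append_right b, key h, key h.symm⟩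

/-- Words that are interchangeable as factors of `u`. -/
def syntacticCon (u : List ℕ) : Con Word where
  r s t := ∀ a b : List ℕ, a ++ letters s ++ b = u ↔ a ++ letters t ++ b = u
  iseqv := ⟨fun _ _ _ => Iff.rfl, fun h a b => (h a b).symm, fun h h' a b => (h a b).trans (h' a b)⟩
  mul' {s t s' t'} h h' a b := by
    have h1 := h a (letters s' ++ b)
    have h2 := h' (a ++ letters t) b
    simp only [letters_mul, List.append_assoc] at h1 h2 ⊢
    exact h1.trans h2

/-- Identities pass to substitution instances and contexts, so the result can only be `p q p p q` or
`p q q p q`; shortness rules out the latter. -/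
theorem substitution_eq_of_short {n : ℕ} (hn : 3 ≤ n) {e : SemigroupIdentity}
    (he : SatisfiesIdentity (upperTriangular₂ (MaxPlus ℤ)) e) (hs : (letters e.1).length < n)
    (θ : Word →ₙ* Word) (a b : List ℕ)
    (hu : a ++ letters (θ e.1) ++ b = adjanWord n (asc n)) :
    a ++ letters (θ e.2) ++ b = adjanWord n (asc n) := by
  have h1 := tropicallyEquiv_of_satisfiesIdentity (e := (θ e.1, θ e.2)) fun φ => he (φ.comp θ)
  have h2 := h1.append a b
  rw [hu] at h2
  refine (h2.eq_or_eq (by omega)).resolve_right fun hv => ?_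
  rw [letters_map] at hu hv
  exact (tropicallyEquiv_of_satisfiesIdentity he).not_substitution hn hs _
    (fun z => List.cons_ne_nil _ _) a b hu hv

theorem not_finitelyBased : ¬ FinitelyBased (upperTriangular₂ (MaxPlus ℤ)) := by
  rintro ⟨E, hfin, hsub, hcons⟩
  obtain ⟨N, hN⟩ : ∃ N, ∀ e ∈ E, (letters e.1).length ≤ N ∧ (letters e.2).length ≤ N := by
    obtain ⟨N, hN⟩ := (hfin.image fun e => (letters e.1).length + (letters e.2).length).bddAbove
    refine ⟨N, fun e he => ?_⟩
    have := hN ⟨e, he, rfl⟩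
    simp only at this
    omega
  -- Index `N + 2` means `n = N + 3`, which exceeds every length in `E` and is at least `3`.
  have hmem : adjanIdentity (N + 2) ∈ consequences E := by
    rw [hcons]
    exact satisfiesIdentity_adjanIdentity (N + 2)
  obtain ⟨hl1, hl2⟩ := letters_adjanIdentity (N + 2)
  have hle : conGen (fun p q : Word => ∃ d ∈ E, ∃ θ : Word →ₙ* Word, p = θ d.1 ∧ q = θ d.2) ≤
      syntacticCon (adjanWord (N + 3) (asc (N + 3))) := by
    rw [Con.conGen_le]
    rintro _ _ ⟨d, hd, θ, rfl, rfl⟩ a b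
    have hlen := hN d hd
    exact ⟨substitution_eq_of_short (by omega) (hsub hd) (by omega) θ a b,
      substitution_eq_of_short (e := d.swap) (by omega) (fun φ => (hsub hd φ).symm)
        (by simp; omega) θ a b⟩
  have := (hle hmem [] []).1 (by simpa using hl1)
  rw [List.nil_append, List.append_nil, hl2] at this
  exact adjanWord_asc_ne_desc (by omega) this.symm

end TropicalWords

theorem corollary5p5 :
    -- `U₂(ℤ ∪ {-∞})` is nonfinitely based
    ¬ FinitelyBased (upperTriangular₂ (MaxPlus ℤ)) ∧
    -- the entrywise inclusion makes it a submonoid of `U₂(ℝ ∪ {-∞})`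
    (∃ ι : upperTriangular₂ (MaxPlus ℤ) →* upperTriangular₂ (MaxPlus ℝ),
      Function.Injective ι ∧
      ∀ M i j, (ι M : Matrix (Fin 2) (Fin 2) (MaxPlus ℝ)) i j =
        MaxPlus.intToReal ((M : Matrix (Fin 2) (Fin 2) (MaxPlus ℤ)) i j)) ∧
    -- it satisfies `u_n ≈ v_n` for all `n ≥ 1`
    (∀ k : ℕ, SatisfiesIdentity (upperTriangular₂ (MaxPlus ℤ)) (adjanIdentity k)) ∧
    -- it contains a copy of the bicyclic monoid as a subsemigroup, generated by two given matrices
    (∃ f : BicyclicMonoid →ₙ* upperTriangular₂ (MaxPlus ℤ), Function.Injective f ∧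
      (f (PresentedMonoid.of bicyclicRel 0) : Matrix (Fin 2) (Fin 2) (MaxPlus ℤ)) =
        !![MaxPlus.ofBot ((-1 : ℤ) : WithBot ℤ), MaxPlus.ofBot ((1 : ℤ) : WithBot ℤ);
           MaxPlus.ofBot ⊥, MaxPlus.ofBot ((1 : ℤ) : WithBot ℤ)] ∧
      (f (PresentedMonoid.of bicyclicRel 1) : Matrix (Fin 2) (Fin 2) (MaxPlus ℤ)) =
        !![MaxPlus.ofBot ((1 : ℤ) : WithBot ℤ), MaxPlus.ofBot ((1 : ℤ) : WithBot ℤ);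
           MaxPlus.ofBot ⊥, MaxPlus.ofBot ((-1 : ℤ) : WithBot ℤ)]) := by
  refine ⟨TropicalWords.not_finitelyBased, ?_, satisfiesIdentity_adjanIdentity, ?_⟩
  · exact ⟨upperTriangular₂.map MaxPlus.intToRealHom,
      upperTriangular₂.map_injective _ MaxPlus.intToReal_injective, fun _ _ _ => rfl⟩
  · refine ⟨Bicyclic.embedding, Bicyclic.embedding_injective, ?_, ?_⟩
    · rw [Bicyclic.coe_embedding_of]; rfl
    · rw [Bicyclic.coe_embedding_of]; rfl
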